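/- For real $a$ let $(a)_n=a(a+1)\cdots(a+n-1)$, $(a)_0=1$, and let ${}_3F_2(a,b,c;1,1;x)=\sum_{n\ge 0}\frac{(a)_n(b)_n(c)_n}{(1)_n^3}x^n$. **Theorem.** (1) (Transformations.) For every real $x$ with $|x|<1$ and $\left|\frac{4x}{(1-x)^2}\right|<1$, both series below converge absolutely and $${}_3F_2\left(\tfrac12,\tfrac12,\tfrac12;1,1;x\right)=(1-x)^{-1/2}\,{}_3F_2\left(\tfrac12,\tfrac14,\tfrac34;1,1;-\tfrac{4x}{(1-x)^2}\right).$$ For every real $x$ with $|x|<1$, both series below converge absolutely and $${}_3F_2\left(\tfrac12,\tfrac12,\tfrac12;1,1;x\right)=\left(1-\tfrac x4\right)^{-1/2}\,{}_3F_2\left(\tfrac12,\tfrac16,\tfrac56;1,1;\tfrac{27x^2}{(4-x)^3}\right).$$ (2) (Equivalences.) For every real number $c$ (in particular for $c=1/\pi$), $$\sum_{n=0}^\infty\frac{(\frac12)_n(\frac14)_n(\frac34)_n}{(1)_n^3}(7n+1)\left(\tfrac{32}{81}\right)^n=\tfrac92\,c\iff\sum_{n=0}^\infty\frac{(\frac12)_n^3}{(1)_n^3}(6n+1)\left(-\tfrac18\right)^n=2\sqrt2\,c,$$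 $$\sum_{n=0}^\infty\frac{(\frac12)_n(\frac16)_n(\frac56)_n}{(1)_n^3}(252n+20)\left(\tfrac{2}{11}\right)^{3n}=11\sqrt{33}\,c\iff\sum_{n=0}^\infty\frac{(\frac12)_n^3}{(1)_n^3}(6n+1)\left(-\tfrac18\right)^n=2\sqrt2\,c.$$ (3) (Summations.) The following series converge absolutely, with the sums $$\sum_{n=0}^\infty\frac{(\frac12)_n^3}{(1)_n^3}(6n+1)\left(-\tfrac18\right)^n=\frac{2\sqrt2}{\pi},\qquad \sum_{n=0}^\infty\frac{(\frac12)_n(\frac14)_n(\frac34)_n}{(1)_n^3}(7n+1)\left(\tfrac{32}{81}\right)^n=\frac{9}{2\pi},$$ $$\sum_{n=0}^\infty\frac{(\frac12)_n(\frac16)_n(\frac56)_n}{(1)_n^3}(252n+20)\left(\tfrac{2}{11}\right)^{3n}=\frac{11\sqrt{33}}{\pi}.$$ -/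

import Mathlib

noncomputable section

/-- The Pochhammer symbol `(a)_n = a (a + 1) ⋯ (a + n - 1)`, with `(a)_0 = 1`. -/
def poch (a : ℝ) (n : ℕ) : ℝ := (ascPochhammer ℝ n).eval a

/-- The `n`-th term of the hypergeometric series `₃F₂(a, b, c; d, e; x)`. -/
def hypTerm (a b c d e x : ℝ) (n : ℕ) : ℝ :=
  poch a n * poch b n * poch c n / (poch d n * poch e n * (n.factorial : ℝ)) * x ^ n

/-- The sum of the hypergeometric series `₃F₂(a, b, c; d, e; x)`. -/
def hyp3F2 (a b c d e x : ℝ) : ℝ := ∑' n : ℕ, hypTerm a b c d e x n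

/-- The coefficient `(1/2)_n (s)_n (1-s)_n / (1)_n ^ 3`. -/
def ramCoeff (s : ℝ) (n : ℕ) : ℝ :=
  poch (1 / 2) n * poch s n * poch (1 - s) n / poch 1 n ^ 3

end

/-! The series at `-1/8` is summed by deforming it with a parameter `j`, replacing the coefficients
by `(1/2+2j)_k (1/2)_k² / (k! (1+j)_k²)`. The deformed sums satisfy `S j = (1 - (1/4)²/(j+1)²) * S
(j+1)` (`tsum_wzTerm`) and tend to 1 (`tendsto_tsum_wzTerm`), so `S 0` is Euler's product for `sin
(π/4) / (π/4)`.

Both transformations have the form `f(x) = (1 - x/q)^(-1/2) g(κ x^r / (1 - x/q)^e)`. Expanding the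
right side by the binomial series and comparing coefficients leaves one finite sum for each power of
`x`, evaluated by creative telescoping (`sum_rowCoeff_quarter`, `sum_rowCoeff_sixth`). Rearranging
the double series proves the formula near 0, and the identity theorem carries it to the stated range
(`ramSeries_half_eq`).

Applying `x d/dx` at `x = -1/8` turns `6n+1` into a multiple of `7n+1` at `32/81`, or of `252n+20`
at `(2/11)^3`. This gives the equivalences, and with them the other two sums. -/

/-! ### The series at -1/8, by a WZ-type recurrence in a parameter. -/

/-- The quotient-form coefficient product for the one-parameter extension of the series
`∑ ((1/2)_k / k!)³ (6 k + 1) (-1/8)^k`. -/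
noncomputable def wzProd (j k : ℕ) : ℝ :=
  ∏ i ∈ Finset.range k, (-(1 / 8) * ((1 / 2 + 2 * (j : ℝ) + i) * (1 / 2 + (i : ℝ)) ^ 2) /
    ((1 + (i : ℝ)) * (1 + (j : ℝ) + i) ^ 2))

/-- The summand of the one-parameter extension. -/
noncomputable def wzTerm (j k : ℕ) : ℝ := (1 + 3 * (k : ℝ) / (1 / 2 + 2 * (j : ℝ))) * wzProd j k

theorem wzProd_zero (j : ℕ) : wzProd j 0 = 1 := by simp [wzProd]

theorem wzProd_succ (j k : ℕ) :
    wzProd j (k + 1) = wzProd j k * (-(1 / 8) * ((1 / 2 + 2 * (j : ℝ) + k) *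
      (1 / 2 + (k : ℝ)) ^ 2) / ((1 + (k : ℝ)) * (1 + (j : ℝ) + k) ^ 2)) :=
  Finset.prod_range_succ _ _

theorem wzProd_shift (j k : ℕ) :
    wzProd (j + 1) k = (1 / 2 + 2 * (j : ℝ) + k) * (1 / 2 + 2 * (j : ℝ) + k + 1) *
      (1 + (j : ℝ)) ^ 2 / ((1 / 2 + 2 * (j : ℝ)) * (1 / 2 + 2 * (j : ℝ) + 1) *
      (1 + (j : ℝ) + k) ^ 2) * wzProd j k := by
  induction k with
  | zero =>
    simp only [wzProd_zero, Nat.cast_zero, add_zero, mul_one]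
    exact (div_self (by positivity)).symm
  | succ k ih =>
    rw [wzProd_succ, wzProd_succ, ih]
    push_cast
    have h1 : (1 / 2 + 2 * (j : ℝ)) ≠ 0 := by positivity
    have h2 : (1 / 2 + 2 * (j : ℝ) + 1) ≠ 0 := by positivity
    have h3 : (1 + (j : ℝ) + k) ≠ 0 := by positivity
    have h4 : (1 + (j : ℝ) + (k + 1)) ≠ 0 := by positivity
    have h5 : (1 + (k : ℝ)) ≠ 0 := by positivity
    have h6 : (1 + ((j : ℝ) + 1) + k) ≠ 0 := by positivity
    field_simp
    ring

/-- The telescoping certificate is `-2k/(1/2+2j) * wzProd j k`. It vanishes at `k = 0` and as `k →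
∞`, so summing over `k` gives the recurrence in `j`. -/
theorem wzTerm_sub (j k : ℕ) :
    wzTerm j k - (1 - (1 / 4 : ℝ) ^ 2 / ((j : ℝ) + 1) ^ 2) * wzTerm (j + 1) k =
      -2 * ((k + 1 : ℕ) : ℝ) / (1 / 2 + 2 * (j : ℝ)) * wzProd j (k + 1) -
      -2 * (k : ℝ) / (1 / 2 + 2 * (j : ℝ)) * wzProd j k := by
  rw [wzTerm, wzTerm, wzProd_shift, wzProd_succ]
  push_cast
  have h1 : (1 / 2 + 2 * (j : ℝ)) ≠ 0 := by positivity
  have h2 : (1 / 2 + 2 * (j : ℝ) + 1) ≠ 0 := by positivity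
  have h3 : (1 + (j : ℝ) + k) ≠ 0 := by positivity
  have h4 : (1 / 2 + 2 * ((j : ℝ) + 1)) ≠ 0 := by positivity
  have h5 : (1 + (k : ℝ)) ≠ 0 := by positivity
  have h6 : ((j : ℝ) + 1) ≠ 0 := by positivity
  field_simp
  ring

/-- Keeping the last fraction allows two uses: bounded by 1 it gives geometric decay uniform in `j`;
bounded by `(k+1)/(1+j)` it gives decay in `j`. -/
theorem abs_wzProd_succ_le (j k : ℕ) :
    |wzProd j (k + 1)| ≤ |wzProd j k| * (1 / 4) * ((1 / 2 + (k : ℝ)) / (1 + (j : ℝ) + k)) := by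
  rw [wzProd_succ, abs_mul, mul_assoc]
  gcongr
  have hj : (0 : ℝ) ≤ j := j.cast_nonneg
  have hk : (0 : ℝ) ≤ k := k.cast_nonneg
  rw [neg_mul, neg_div, abs_neg, abs_of_nonneg (by positivity), ← sub_nonneg]
  have : 1 / 4 * ((1 / 2 + (k : ℝ)) / (1 + (j : ℝ) + k)) -
      1 / 8 * ((1 / 2 + 2 * (j : ℝ) + k) * (1 / 2 + (k : ℝ)) ^ 2) /
        ((1 + (k : ℝ)) * (1 + (j : ℝ) + k) ^ 2) =
      (1 / 2 + k) / (8 * (1 + k) * (1 + j + k) ^ 2) *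
        (2 * (1 + k) * (1 + j + k) - (1 / 2 + 2 * j + k) * (1 / 2 + k)) := by
    field_simp
    ring
  rw [this]
  refine mul_nonneg (by positivity) ?_
  nlinarith [mul_nonneg hj hk]

theorem abs_wzProd_le (j k : ℕ) : |wzProd j k| ≤ (1 / 4) ^ k := by
  induction k with
  | zero => simp [wzProd_zero]
  | succ k ih =>
    refine (abs_wzProd_succ_le j k).trans ?_
    have h : (1 / 2 + (k : ℝ)) / (1 + (j : ℝ) + k) ≤ 1 := by
      rw [div_le_one (by positivity)]
      have := j.cast_nonneg (α := ℝ)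
      linarith
    calc |wzProd j k| * (1 / 4) * ((1 / 2 + (k : ℝ)) / (1 + (j : ℝ) + k))
        ≤ (1 / 4) ^ k * (1 / 4) * 1 := by gcongr
      _ = (1 / 4) ^ (k + 1) := by ring

theorem abs_wzProd_succ_le_div (j k : ℕ) :
    |wzProd j (k + 1)| ≤ (1 / 4) ^ (k + 1) / (1 + (j : ℝ)) * (k + 1) := by
  refine (abs_wzProd_succ_le j k).trans ?_
  have hj : (0 : ℝ) ≤ j := j.cast_nonneg
  have hk : (0 : ℝ) ≤ k := k.cast_nonneg
  calc |wzProd j k| * (1 / 4) * ((1 / 2 + (k : ℝ)) / (1 + (j : ℝ) + k))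
      ≤ (1 / 4) ^ k * (1 / 4) * ((k + 1) / (1 + j)) := by
        gcongr ?_ * _ * (?_ / ?_)
        · exact abs_wzProd_le j k
        · linarith
        · linarith
    _ = _ := by ring

theorem wzTerm_factor_le (j k : ℕ) :
    1 + 3 * (k : ℝ) / (1 / 2 + 2 * (j : ℝ)) ≤ 1 + 6 * k := by
  have hj : (0 : ℝ) ≤ j := j.cast_nonneg
  have hk : (0 : ℝ) ≤ k := k.cast_nonneg
  gcongr
  rw [div_le_iff₀ (by positivity)]
  nlinarith [mul_nonneg hj hk]

theorem abs_wzTerm (j k : ℕ) :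
    |wzTerm j k| = (1 + 3 * (k : ℝ) / (1 / 2 + 2 * (j : ℝ))) * |wzProd j k| := by
  rw [wzTerm, abs_mul, abs_of_nonneg (by positivity)]

theorem summable_wzBound :
    Summable fun k : ℕ => (1 + 6 * (k : ℝ)) * (k + 1) * (1 / 4 : ℝ) ^ k := by
  have h (p : ℕ) : Summable fun k : ℕ => (k : ℝ) ^ p * (1 / 4 : ℝ) ^ k :=
    summable_pow_mul_geometric_of_norm_lt_one p (by norm_num)
  refine (((h 2).mul_left 6).add (((h 1).mul_left 7).add (h 0))).congr fun k => ?_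
  ring

theorem summable_wzTerm (j : ℕ) : Summable (wzTerm j) := by
  refine Summable.of_norm_bounded summable_wzBound fun k => ?_
  rw [Real.norm_eq_abs, abs_wzTerm]
  have hk : (0 : ℝ) ≤ k := k.cast_nonneg
  calc _ ≤ (1 + 6 * (k : ℝ)) * (1 / 4) ^ k := by
        gcongr ?_ * ?_
        · exact wzTerm_factor_le j k
        · exact abs_wzProd_le j k
    _ ≤ _ := by
        gcongr
        nlinarith

theorem tsum_wzTerm (j : ℕ) :
    ∑' k, wzTerm j k =
      (1 - (1 / 4 : ℝ) ^ 2 / ((j : ℝ) + 1) ^ 2) * ∑' k, wzTerm (j + 1) k := by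
  set c : ℝ := 1 - (1 / 4 : ℝ) ^ 2 / ((j : ℝ) + 1) ^ 2
  have h1 := ((summable_wzTerm j).hasSum.sub
    ((summable_wzTerm (j + 1)).hasSum.mul_left c)).tendsto_sum_nat
  have h2 : Filter.Tendsto (fun n : ℕ => -2 * (n : ℝ) / (1 / 2 + 2 * (j : ℝ)) * wzProd j n)
      Filter.atTop (nhds 0) := by
    have h3 := (summable_pow_mul_geometric_of_norm_lt_one 1
      (show ‖(1 / 4 : ℝ)‖ < 1 by norm_num)).tendsto_atTop_zero
    refine squeeze_zero_norm (fun n => ?_) (by simpa only [mul_zero] using h3.const_mul 4)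
    have hj : (0 : ℝ) ≤ j := j.cast_nonneg
    rw [norm_mul, Real.norm_eq_abs, Real.norm_eq_abs, neg_mul, neg_div, abs_neg,
      abs_of_nonneg (by positivity), pow_one, ← mul_assoc]
    gcongr
    · rw [div_le_iff₀ (by positivity)]
      nlinarith [mul_nonneg hj (n.cast_nonneg (α := ℝ))]
    · simpa using abs_wzProd_le j n
  have h4 := tendsto_nhds_unique h1 (h2.congr fun n => ?_)
  · linarith
  · rw [Finset.sum_congr rfl fun k _ => wzTerm_sub j k,
      Finset.sum_range_sub (fun k : ℕ => -2 * (k : ℝ) / (1 / 2 + 2 * (j : ℝ)) * wzProd j k)]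
    simp

/-- The term `k = 0` is exactly 1, and the remaining terms together are at most a constant over `j +
1`. -/
theorem tendsto_tsum_wzTerm :
    Filter.Tendsto (fun j => ∑' k, wzTerm j k) Filter.atTop (nhds 1) := by
  have hlim := (tendsto_one_div_add_atTop_nhds_zero_nat (𝕜 := ℝ)).const_mul
    (∑' k : ℕ, (1 + 6 * ((k + 1 : ℕ) : ℝ)) * ((k + 1 : ℕ) + 1) * (1 / 4 : ℝ) ^ (k + 1))
  rw [mul_zero] at hlim
  refine tendsto_iff_norm_sub_tendsto_zero.2
    (squeeze_zero (fun _ => norm_nonneg _) (fun j => ?_) hlim)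
  have hs := (summable_wzTerm j).tsum_eq_zero_add
  rw [hs, wzTerm, wzProd_zero]
  simp only [Nat.cast_zero, mul_zero, zero_div, add_zero, mul_one, add_sub_cancel_left]
  have hB := (summable_nat_add_iff (f := fun k : ℕ =>
    (1 + 6 * (k : ℝ)) * (k + 1) * (1 / 4 : ℝ) ^ k) 1).2 summable_wzBound
  refine tsum_of_norm_bounded (hB.hasSum.mul_right _) fun k => ?_
  rw [Real.norm_eq_abs, abs_wzTerm]
  calc _ ≤ (1 + 6 * ((k + 1 : ℕ) : ℝ)) * ((1 / 4) ^ (k + 1) / (1 + (j : ℝ)) * (k + 1)) := by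
        gcongr ?_ * ?_
        · exact wzTerm_factor_le j (k + 1)
        · exact abs_wzProd_succ_le_div j k
    _ ≤ (1 + 6 * ((k + 1 : ℕ) : ℝ)) * ((1 / 4) ^ (k + 1) / (1 + (j : ℝ)) * ((k + 1 : ℕ) + 1)) := by
        gcongr
        linarith
    _ = _ := by
        rw [add_comm (1 : ℝ) (j : ℝ)]
        ring

theorem tsum_wzTerm_zero : ∑' k, wzTerm 0 k = 2 * Real.sqrt 2 / Real.pi := by
  have h (N : ℕ) : ∑' k, wzTerm 0 k =
      (∏ j ∈ Finset.range N, (1 - (1 / 4 : ℝ) ^ 2 / ((j : ℝ) + 1) ^ 2)) * ∑' k, wzTerm N k := by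
    induction N with
    | zero => simp
    | succ N ih => rw [ih, Finset.prod_range_succ, tsum_wzTerm N, mul_assoc]
  have h1 := (Real.tendsto_euler_sin_prod (1 / 4)).mul tendsto_tsum_wzTerm
  have h2 := tendsto_nhds_unique (h1.congr fun N => by rw [mul_assoc, ← h N]) tendsto_const_nhds
  rw [mul_one, show Real.pi * (1 / 4) = Real.pi / 4 by ring, Real.sin_pi_div_four] at h2
  rw [eq_div_iff Real.pi_ne_zero]
  linarith

/-! ### Pochhammer symbols and the undeformed series. -/

theorem poch_zero (a : ℝ) : poch a 0 = 1 := by simp [poch]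

theorem poch_succ (a : ℝ) (n : ℕ) : poch a (n + 1) = poch a n * (a + n) :=
  ascPochhammer_succ_eval n a

theorem poch_one (n : ℕ) : poch 1 n = (n.factorial : ℝ) := ascPochhammer_eval_one ℝ n

theorem poch_pos {a : ℝ} (ha : 0 < a) (n : ℕ) : 0 < poch a n := ascPochhammer_pos n a ha

theorem poch_add (a : ℝ) (m n : ℕ) : poch a (m + n) = poch a m * poch (a + m) n := by
  induction n with
  | zero => simp [poch_zero]
  | succ n ih =>
    rw [← add_assoc, poch_succ, ih, poch_succ]
    push_cast
    ring

theorem poch_le_poch {a b : ℝ} (ha : 0 < a) (hab : a ≤ b) (n : ℕ) : poch a n ≤ poch b n := by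
  induction n with
  | zero => simp [poch_zero]
  | succ n ih =>
    rw [poch_succ, poch_succ]
    have := poch_pos (ha.trans_le hab) n
    gcongr

theorem wzTerm_zero_eq (n : ℕ) :
    wzTerm 0 n = ramCoeff (1 / 2) n * (6 * (n : ℝ) + 1) * (-(1 / 8) : ℝ) ^ n := by
  have h : wzProd 0 n = ramCoeff (1 / 2) n * (-(1 / 8) : ℝ) ^ n := by
    induction n with
    | zero => simp [wzProd_zero, ramCoeff, poch_zero]
    | succ n ih =>
      rw [wzProd_succ, ih, ramCoeff, ramCoeff]
      simp only [poch_succ, poch_one]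
      have := n.factorial_ne_zero
      norm_num only
      field_simp
      ring
  rw [wzTerm, h]
  push_cast
  ring

theorem hasSum_ramCoeff_half :
    HasSum (fun n : ℕ => ramCoeff (1 / 2) n * (6 * (n : ℝ) + 1) * (-(1 / 8) : ℝ) ^ n)
      (2 * Real.sqrt 2 / Real.pi) := by
  rw [← tsum_wzTerm_zero]
  exact (summable_wzTerm 0).hasSum.congr_fun fun n => (wzTerm_zero_eq n).symm

/-! ### Analyticity and termwise differentiation of the power series. -/

/-- The function `∑ (1/2)_n (s)_n (1-s)_n / n!³ xⁿ`. -/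
noncomputable def ramSeries (s x : ℝ) : ℝ := ∑' n, ramCoeff s n * x ^ n

theorem hypTerm_eq_ramCoeff (s x : ℝ) :
    hypTerm (1 / 2) s (1 - s) 1 1 x = fun n => ramCoeff s n * x ^ n := by
  funext n
  rw [hypTerm, ramCoeff, poch_one]
  ring

theorem ramCoeff_nonneg {s : ℝ} (h0 : 0 < s) (h1 : s < 1) (n : ℕ) : 0 ≤ ramCoeff s n := by
  have := poch_pos (show (0 : ℝ) < 1 / 2 by norm_num) n
  have := poch_pos h0 n
  have := poch_pos (sub_pos.2 h1) n
  have := poch_pos one_pos n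
  rw [ramCoeff]
  positivity

theorem ramCoeff_le_one {s : ℝ} (h0 : 0 < s) (h1 : s < 1) (n : ℕ) : ramCoeff s n ≤ 1 := by
  have h2 := poch_pos one_pos n
  have h3 := poch_pos h0 n
  have h4 := poch_pos (sub_pos.2 h1) n
  rw [ramCoeff, div_le_one (by positivity), pow_three, ← mul_assoc]
  gcongr
  · exact poch_le_poch (by norm_num) (by norm_num) n
  · exact poch_le_poch h0 h1.le n
  · exact poch_le_poch (sub_pos.2 h1) (by linarith) n

theorem norm_ramCoeff_le {s : ℝ} (h0 : 0 < s) (h1 : s < 1) (n : ℕ) : ‖ramCoeff s n‖ ≤ 1 := by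
  rw [Real.norm_of_nonneg (ramCoeff_nonneg h0 h1 n)]
  exact ramCoeff_le_one h0 h1 n

theorem summable_nat_mul_ramCoeff {s x : ℝ} (h0 : 0 < s) (h1 : s < 1) (hx : |x| < 1) (p : ℕ) :
    Summable fun n : ℕ => (n : ℝ) ^ p * (ramCoeff s n * x ^ n) := by
  refine Summable.of_norm_bounded (g := fun n : ℕ => (n : ℝ) ^ p * |x| ^ n)
    (summable_pow_mul_geometric_of_norm_lt_one p (by simpa using hx)) fun n => ?_
  rw [norm_mul, norm_mul, norm_pow, norm_pow, Real.norm_natCast, Real.norm_eq_abs x]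
  gcongr
  exact mul_le_of_le_one_left (by positivity) (norm_ramCoeff_le h0 h1 n)

theorem summable_ramCoeff {s x : ℝ} (h0 : 0 < s) (h1 : s < 1) (hx : |x| < 1) :
    Summable fun n : ℕ => ramCoeff s n * x ^ n := by
  simpa using summable_nat_mul_ramCoeff h0 h1 hx 0

theorem hasFPowerSeriesOnBall_ramSeries {s : ℝ} (h0 : 0 < s) (h1 : s < 1) :
    HasFPowerSeriesOnBall (ramSeries s) (FormalMultilinearSeries.ofScalars ℝ (ramCoeff s)) 0 1 := by
  set p := FormalMultilinearSeries.ofScalars ℝ (ramCoeff s)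
  have hr : (1 : ENNReal) ≤ p.radius := by
    refine p.le_radius_of_bound (r := 1) 1 fun n => ?_
    simpa [p, FormalMultilinearSeries.ofScalars_norm] using norm_ramCoeff_le h0 h1 n
  have hp : p.sum = ramSeries s := by
    funext x
    have := congrFun (FormalMultilinearSeries.ofScalarsSum_eq_tsum (E := ℝ) (ramCoeff s)) x
    simpa [FormalMultilinearSeries.ofScalarsSum, ramSeries, p] using this
  rw [← hp]
  exact (p.hasFPowerSeriesOnBall (one_pos.trans_le hr)).mono one_pos hr

theorem analyticAt_ramSeries {s x : ℝ} (h0 : 0 < s) (h1 : s < 1) (hx : |x| < 1) :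
    AnalyticAt ℝ (ramSeries s) x := by
  refine (hasFPowerSeriesOnBall_ramSeries h0 h1).analyticAt_of_mem ?_
  rw [← ENNReal.ofReal_one, Metric.eball_ofReal]
  simpa using hx

theorem tsum_nat_mul_ramCoeff {s x : ℝ} (h0 : 0 < s) (h1 : s < 1) (hx : |x| < 1) :
    ∑' n : ℕ, (n : ℝ) * (ramCoeff s n * x ^ n) = x * deriv (ramSeries s) x := by
  -- Termwise differentiation needs a uniform majorant, here `n * r^(n-1)` on the ball of a radius
  -- strictly between `|x|` and 1.
  obtain ⟨r, hxr, hr1⟩ := exists_between hx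
  have hr0 : 0 ≤ r := (abs_nonneg x).trans hxr.le
  have hu : Summable fun n : ℕ => (n : ℝ) * r ^ (n - 1) := by
    refine (summable_nat_add_iff 1).1 ?_
    have h (p : ℕ) := summable_pow_mul_geometric_of_norm_lt_one p
      (show ‖r‖ < 1 by rwa [Real.norm_of_nonneg hr0])
    refine ((h 1).add (h 0)).congr fun n => ?_
    push_cast
    ring
  have hd := hasDerivAt_tsum_of_isPreconnected (𝕜 := ℝ) (t := Metric.ball (0 : ℝ) r) (y₀ := 0)
    (g := fun n y => ramCoeff s n * y ^ n) (y := x)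
    (g' := fun n y => ramCoeff s n * ((n : ℝ) * y ^ (n - 1))) hu Metric.isOpen_ball
    (convex_ball _ _).isPreconnected (fun n y _ => (hasDerivAt_pow n y).const_mul _)
    (fun n y hy => ?_) (Metric.mem_ball_self ((abs_nonneg x).trans_lt hxr))
    (by simpa using summable_ramCoeff h0 h1 (x := 0) (by simp)) (by simpa using hxr)
  · have hd' : deriv (ramSeries s) x = ∑' n : ℕ, ramCoeff s n * ((n : ℝ) * x ^ (n - 1)) := hd.deriv
    rw [hd', ← tsum_mul_left]
    refine tsum_congr fun n => ?_
    rcases n with _ | n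
    · simp
    · simp only [add_tsub_cancel_right]
      ring
  · have hy' : |y| ≤ r := by simpa using (Metric.mem_ball.1 hy).le
    rw [norm_mul, norm_mul, norm_pow, Real.norm_natCast, Real.norm_eq_abs y]
    refine (mul_le_of_le_one_left (by positivity) (norm_ramCoeff_le h0 h1 n)).trans ?_
    gcongr

theorem hasSum_linear_mul_ramCoeff {s x : ℝ} (h0 : 0 < s) (h1 : s < 1) (hx : |x| < 1)
    (α β : ℝ) :
    HasSum (fun n : ℕ => ramCoeff s n * (α * (n : ℝ) + β) * x ^ n)
      (α * (x * deriv (ramSeries s) x) + β * ramSeries s x) := by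
  rw [← tsum_nat_mul_ramCoeff h0 h1 hx]
  have h2 := (summable_nat_mul_ramCoeff h0 h1 hx 1).hasSum.mul_left α
  have h3 := (summable_ramCoeff h0 h1 hx).hasSum.mul_left β
  simp only [pow_one] at h2
  refine (h2.add h3).congr_fun fun n => ?_
  ring

/-! ### Binomial expansion and rearrangement near the origin. -/

theorem choose_eq_poch (a : ℝ) (n : ℕ) :
    Ring.choose (a + n - 1) n = poch a n / (n.factorial : ℝ) := by
  rw [Ring.choose_eq_smul, Polynomial.descPochhammer_smeval_eq_ascPochhammer,
    Polynomial.ascPochhammer_smeval_cast, Polynomial.ascPochhammer_smeval_eq_eval, poch]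
  rw [show a + n - 1 - n + 1 = a by ring, smul_eq_mul, mul_comm, div_eq_mul_inv]

/-- The binomial series with exponent `-a`. -/
theorem hasSum_poch_div_factorial (a : ℝ) {x : ℝ} (hx : |x| < 1) :
    HasSum (fun n : ℕ => poch a n / (n.factorial : ℝ) * x ^ n) ((1 - x) ^ (-a)) := by
  have h := (Real.one_div_one_sub_rpow_hasFPowerSeriesOnBall_zero a).hasSum (y := x) (by
    rw [← ENNReal.ofReal_one, Metric.eball_ofReal]
    simpa using hx)
  have hx1 : 0 < 1 - x := by linarith [(abs_lt.1 hx).2]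
  rw [Real.rpow_neg hx1.le]
  simpa [FormalMultilinearSeries.ofScalars, List.prod_ofFn, choose_eq_poch, mul_comm] using h

/-- The coefficient of `x ^ m` in the expansion of `x ^ (r n) (1 - x / q) ^ (-(1 / 2 + e n))`. -/
noncomputable def rowCoeff (q : ℝ) (r e n m : ℕ) : ℝ :=
  if r * n ≤ m then
    poch (1 / 2 + (e : ℝ) * n) (m - r * n) / ((m - r * n).factorial : ℝ) / q ^ (m - r * n)
  else 0

theorem rowCoeff_nonneg {q : ℝ} (hq : 0 < q) (r e n m : ℕ) : 0 ≤ rowCoeff q r e n m := by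
  rw [rowCoeff]
  split_ifs
  · have := poch_pos (show (0 : ℝ) < 1 / 2 + (e : ℝ) * n by positivity) (m - r * n)
    positivity
  · exact le_rfl

theorem rpow_neg_half_sub {y : ℝ} (hy : 0 < y) (e n : ℕ) :
    y ^ (-(1 / 2 + (e : ℝ) * n)) = y ^ (-(1 / 2) : ℝ) * (1 / y ^ e) ^ n := by
  rw [neg_add, Real.rpow_add hy, Real.rpow_neg hy.le ((e : ℝ) * n), ← Nat.cast_mul,
    Real.rpow_natCast, pow_mul, one_div_pow, ← one_div]

theorem hasSum_rowCoeff {q x : ℝ} (hq : 0 < q) (hx : |x| < q) (r e n : ℕ) :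
    HasSum (fun m => rowCoeff q r e n m * x ^ m)
      ((1 - x / q) ^ (-(1 / 2) : ℝ) * (x ^ r / (1 - x / q) ^ e) ^ n) := by
  have hxq : |x / q| < 1 := by rwa [abs_div, abs_of_pos hq, div_lt_one hq]
  have hy : 0 < 1 - x / q := by linarith [(abs_lt.1 hxq).2]
  have h := (hasSum_poch_div_factorial (1 / 2 + (e : ℝ) * n) hxq).mul_left (x ^ (r * n))
  rw [rpow_neg_half_sub hy] at h
  rw [show (1 - x / q) ^ (-(1 / 2) : ℝ) * (x ^ r / (1 - x / q) ^ e) ^ n =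
    x ^ (r * n) * ((1 - x / q) ^ (-(1 / 2) : ℝ) * (1 / (1 - x / q) ^ e) ^ n) by
      rw [pow_mul, div_eq_mul_one_div (x ^ r), mul_pow]; ring]
  -- The factor `x^(r n)` shifts exponents by `m = k + r * n`; outside the range of this shift
  -- `rowCoeff` is zero.
  refine ((add_left_injective (r * n)).hasSum_iff fun m hm => ?_).1 (h.congr_fun fun k => ?_)
  · rw [rowCoeff, if_neg, zero_mul]
    intro hle
    exact hm ⟨m - r * n, Nat.sub_add_cancel hle⟩
  · simp only [Function.comp_apply, rowCoeff, le_add_iff_nonneg_left, zero_le, if_true,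
      add_tsub_cancel_right, pow_add, div_pow]
    ring

/-- Fubini for the double series in `n` and `m`. Since `ramCoeff` and `rowCoeff` are nonnegative,
the series of absolute values is the same expansion at `|x|` and `|κ|`; hence the hypothesis at
`|x|`, which can be stronger than convergence of the right side at `x`. -/
theorem ramSeries_half_eq_of_coeff {s q κ x : ℝ} {r e : ℕ} (h0 : 0 < s) (h1 : s < 1)
    (hq : 0 < q) (hr : 0 < r)
    (hc : ∀ m, ∑ n ∈ Finset.range (m + 1), ramCoeff s n * κ ^ n * rowCoeff q r e n m =
      ramCoeff (1 / 2) m)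
    (hx : |x| < q) (hρ : |κ| * (|x| ^ r / (1 - |x| / q) ^ e) < 1) :
    ramSeries (1 / 2) x =
      (1 - x / q) ^ (-(1 / 2) : ℝ) * ramSeries s (κ * (x ^ r / (1 - x / q) ^ e)) := by
  have hrow (n : ℕ) := (hasSum_rowCoeff hq hx r e n).mul_left (ramCoeff s n * κ ^ n)
  have habs (n : ℕ) := (hasSum_rowCoeff (x := |x|) hq (by rwa [abs_abs]) r e n).mul_left
    (ramCoeff s n * |κ| ^ n)
  have hy : 0 < 1 - |x| / q := by rw [sub_pos, div_lt_one hq]; exact hx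
  have hs : Summable (Function.uncurry fun n m =>
      ramCoeff s n * κ ^ n * (rowCoeff q r e n m * x ^ m)) := by
    have hn : ∀ p : ℕ × ℕ, ‖Function.uncurry (fun n m =>
        ramCoeff s n * κ ^ n * (rowCoeff q r e n m * x ^ m)) p‖ =
        ramCoeff s p.1 * |κ| ^ p.1 * (rowCoeff q r e p.1 p.2 * |x| ^ p.2) := by
      intro p
      simp only [Function.uncurry, norm_mul, norm_pow, Real.norm_eq_abs,
        abs_of_nonneg (ramCoeff_nonneg h0 h1 p.1), abs_of_nonneg (rowCoeff_nonneg hq r e p.1 p.2)]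
    refine Summable.of_norm ((summable_prod_of_nonneg fun p => norm_nonneg _).2 ⟨fun n => ?_, ?_⟩)
    · simp only [hn]
      exact (habs n).summable
    · simp only [hn, (habs _).tsum_eq]
      have hg : |(|κ| * (|x| ^ r / (1 - |x| / q) ^ e))| < 1 := by
        rwa [abs_of_nonneg (by positivity)]
      refine ((summable_ramCoeff h0 h1 hg).mul_left
        ((1 - |x| / q) ^ (-(1 / 2) : ℝ))).congr fun n => ?_
      rw [mul_pow]
      ring
  have hcomm := hs.tsum_comm
  simp only [(hrow _).tsum_eq] at hcomm
  have hcol (m : ℕ) : ramCoeff (1 / 2) m * x ^ m =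
      ∑' n, ramCoeff s n * κ ^ n * (rowCoeff q r e n m * x ^ m) := by
    rw [← hc m, Finset.sum_mul, tsum_eq_sum (s := Finset.range (m + 1)) fun n hn => ?_]
    · exact Finset.sum_congr rfl fun n _ => by ring
    · rw [rowCoeff, if_neg, zero_mul, mul_zero]
      rw [Finset.mem_range, not_lt] at hn
      have := Nat.le_mul_of_pos_left n hr
      omega
  rw [ramSeries, ramSeries, ← tsum_mul_left, tsum_congr hcol, hcomm]
  refine tsum_congr fun n => ?_
  rw [mul_pow]
  ring

/-! ### Coefficient identities by creative telescoping. -/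

/-- `1 / (m - n)!`, read as zero for `m < n`. -/
noncomputable def invFact (m n : ℕ) : ℝ := (m.descFactorial n : ℝ) / (m.factorial : ℝ)

theorem invFact_of_le {m n : ℕ} (h : n ≤ m) : invFact m n = 1 / ((m - n).factorial : ℝ) := by
  rw [invFact, ← Nat.factorial_mul_descFactorial h, Nat.cast_mul]
  have := (m - n).factorial_ne_zero
  have : m.descFactorial n ≠ 0 := by rw [Ne, Nat.descFactorial_eq_zero_iff_lt]; omega
  field_simp

theorem invFact_of_lt {m n : ℕ} (h : m < n) : invFact m n = 0 := by
  rw [invFact, Nat.descFactorial_eq_zero_iff_lt.2 h, Nat.cast_zero, zero_div]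

theorem invFact_succ_right (m n : ℕ) : invFact m (n + 1) = ((m : ℝ) - n) * invFact m n := by
  rcases le_or_gt n m with h | h
  · rw [invFact, invFact, Nat.descFactorial_succ, Nat.cast_mul, Nat.cast_sub h]
    ring
  · rw [invFact_of_lt h, invFact_of_lt (h.trans n.lt_succ_self), mul_zero]

theorem invFact_succ_left (m n : ℕ) :
    invFact m n = ((m : ℝ) + 1 - n) * invFact (m + 1) n := by
  rcases le_or_gt n m with h | h
  · rw [invFact_of_le h, invFact_of_le (h.trans m.le_succ), Nat.succ_sub h, Nat.factorial_succ]
    push_cast [Nat.cast_sub h]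
    have := (m - n).factorial_ne_zero
    have : (m : ℝ) - n + 1 ≠ 0 := by rw [← Nat.cast_sub h]; positivity
    field_simp
    ring
  · rw [invFact_of_lt h]
    rcases (Nat.succ_le_of_lt h).eq_or_lt with h | h
    · rw [← h]; push_cast; ring
    · rw [invFact_of_lt h, mul_zero]

theorem ramCoeff_half_succ (m : ℕ) :
    ((m : ℝ) + 1) ^ 3 * ramCoeff (1 / 2) (m + 1) =
      ((m : ℝ) + 1 / 2) ^ 3 * ramCoeff (1 / 2) m := by
  rw [ramCoeff, ramCoeff]
  simp only [poch_succ, poch_one]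
  have := m.factorial_ne_zero
  norm_num only
  field_simp
  ring

/-- A sequence of finite sums obeying the recurrence of `((1/2)_m / m!)³` by creative
telescoping equals that sequence. -/
theorem sum_eq_ramCoeff_half (F G : ℕ → ℕ → ℝ) (hF0 : F 0 0 = 1)
    (hF : ∀ m n, m < n → F m n = 0) (hG0 : ∀ m, G m 0 = 0)
    (hG : ∀ m n, m + 1 < n → G m n = 0)
    (h : ∀ m n : ℕ, ((m : ℝ) + 1) ^ 3 * F (m + 1) n - ((m : ℝ) + 1 / 2) ^ 3 * F m n =
      G m (n + 1) - G m n) (m : ℕ) :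
    ∑ n ∈ Finset.range (m + 1), F m n = ramCoeff (1 / 2) m := by
  induction m with
  | zero => simp [hF0, ramCoeff, poch_zero]
  | succ m ih =>
    -- The range must reach `n = m + 1`, the last term of the sum for `m + 1`; there `F m` vanishes,
    -- and so does `G m` at both ends.
    have h1 := Finset.sum_range_sub (G m) (m + 2)
    rw [← Finset.sum_congr rfl fun n _ => h m n, Finset.sum_sub_distrib, ← Finset.mul_sum,
      ← Finset.mul_sum, hG0, hG m (m + 2) (by omega), Finset.sum_range_succ (F m),
      hF m (m + 1) (by omega), add_zero, ih, ← ramCoeff_half_succ] at h1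
    have h2 : ((m : ℝ) + 1) ^ 3 ≠ 0 := by positivity
    exact mul_left_cancel₀ h2 (by linarith)

theorem poch_two_mul (n : ℕ) :
    poch (1 / 2) (2 * n) = poch (1 / 4) n * poch (3 / 4) n * 4 ^ n := by
  induction n with
  | zero => simp [poch_zero]
  | succ n ih =>
    rw [show 2 * (n + 1) = 2 * n + 1 + 1 by ring]
    simp only [poch_succ, ih]
    push_cast
    ring

theorem poch_three_mul (n : ℕ) :
    poch (1 / 2) (3 * n) = poch (1 / 2) n * poch (1 / 6) n * poch (5 / 6) n * 27 ^ n := by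
  induction n with
  | zero => simp [poch_zero]
  | succ n ih =>
    rw [show 3 * (n + 1) = 3 * n + 1 + 1 + 1 by ring]
    simp only [poch_succ, ih]
    push_cast
    ring

/-- Since `(1/4)_n (3/4)_n 4^n = (1/2)_{2n}`, the Pochhammer symbols merge into `(1/2)_{m+n}`. In
`H` the index `k` is kept apart from `m` because the certificate uses `1/(m+1-n)!` alongside
`(1/2)_{m+n}`. -/
theorem sum_rowCoeff_quarter (m : ℕ) :
    ∑ n ∈ Finset.range (m + 1), ramCoeff (1 / 4) n * (-4) ^ n * rowCoeff 1 1 2 n m =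
      ramCoeff (1 / 2) m := by
  let H (m k n : ℕ) : ℝ :=
    poch (1 / 2) n * poch (1 / 2) (m + n) * (-1) ^ n * invFact k n / (n.factorial : ℝ) ^ 3
  rw [← sum_eq_ramCoeff_half (fun m n => H m m n)
    (fun m n => -(2 * (m : ℝ) + 3 / 2) * (n : ℝ) ^ 3 * H m (m + 1) n)]
  · refine Finset.sum_congr rfl fun n hn => ?_
    have hnm : n ≤ m := Nat.lt_succ_iff.1 (Finset.mem_range.1 hn)
    obtain ⟨k, rfl⟩ := Nat.exists_eq_add_of_le hnm
    have h1 := poch_add (1 / 2) (2 * n) k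
    rw [poch_two_mul] at h1
    simp only [H, invFact_of_le hnm, rowCoeff, one_mul, if_pos hnm, ramCoeff, poch_one,
      add_tsub_cancel_left, one_pow, div_one]
    rw [show n + k + n = 2 * n + k by ring, h1, show (-4 : ℝ) ^ n = (-1) ^ n * 4 ^ n by
      rw [← mul_pow]; norm_num, show (1 : ℝ) - 1 / 4 = 3 / 4 by norm_num]
    push_cast
    ring
  · simp [H, poch_zero, invFact]
  · intro m n h
    simp [H, invFact_of_lt h]
  · simp
  · intro m n h
    simp [H, invFact_of_lt h]
  · intro m n
    simp only [H, invFact_succ_left m n, invFact_succ_right, poch_succ, Nat.factorial_succ,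
      show m + 1 + n = m + n + 1 by ring, show m + (n + 1) = m + n + 1 by ring, pow_succ]
    have := n.factorial_ne_zero
    push_cast
    field_simp
    ring

/-- As in the quarter case, now with `(1/2)_n (1/6)_n (5/6)_n 27^n = (1/2)_{3n}`; the powers of 4
combine to `4^(-(m+n))`. -/
theorem sum_rowCoeff_sixth (m : ℕ) :
    ∑ n ∈ Finset.range (m + 1), ramCoeff (1 / 6) n * (27 / 64) ^ n * rowCoeff 4 2 3 n m =
      ramCoeff (1 / 2) m := by
  let H (m k n : ℕ) : ℝ :=
    poch (1 / 2) (m + n) * (1 / 4) ^ (m + n) * invFact k (2 * n) / (n.factorial : ℝ) ^ 3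
  rw [← sum_eq_ramCoeff_half (fun m n => H m m n)
    (fun m n => -(3 * (m : ℝ) + 2) * (n : ℝ) ^ 3 * H m (m + 1) n)]
  · refine Finset.sum_congr rfl fun n hn => ?_
    by_cases hnm : 2 * n ≤ m
    · obtain ⟨k, rfl⟩ := Nat.exists_eq_add_of_le hnm
      have h1 := poch_add (1 / 2) (3 * n) k
      rw [poch_three_mul] at h1
      simp only [H, invFact_of_le hnm, rowCoeff, if_pos hnm, ramCoeff, poch_one,
        add_tsub_cancel_left]
      rw [show 2 * n + k + n = 3 * n + k by ring, h1, pow_add, pow_mul,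
        show (1 : ℝ) - 1 / 6 = 5 / 6 by norm_num, show (27 / 64 : ℝ) = 27 * (1 / 4) ^ 3 by norm_num,
        mul_pow]
      push_cast
      simp only [one_div, inv_pow]
      ring
    · simp [H, invFact_of_lt (not_le.1 hnm), rowCoeff, hnm]
  · simp [H, poch_zero, invFact]
  · intro m n h
    simp [H, invFact_of_lt (show m < 2 * n by omega)]
  · simp
  · intro m n h
    simp [H, invFact_of_lt (show m + 1 < 2 * n by omega)]
  · intro m n
    simp only [H, invFact_succ_left m (2 * n), invFact_succ_right, poch_succ, Nat.factorial_succ,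
      show m + 1 + n = m + n + 1 by ring, show m + (n + 1) = m + n + 1 by ring, pow_succ,
      show 2 * (n + 1) = 2 * n + 1 + 1 by ring]
    have := n.factorial_ne_zero
    push_cast
    field_simp
    ring

/-! ### Continuation along the segment from 0, and the logarithmic derivative. -/

theorem ramSeries_half_eq {s q κ x : ℝ} {r e : ℕ} (h0 : 0 < s) (h1 : s < 1)
    (hq : 1 ≤ q) (hr : 0 < r)
    (hc : ∀ m, ∑ n ∈ Finset.range (m + 1), ramCoeff s n * κ ^ n * rowCoeff q r e n m =
      ramCoeff (1 / 2) m)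
    (hx : |x| < 1) (hU : ∀ z ∈ Set.uIcc 0 x, |κ * (z ^ r / (1 - z / q) ^ e)| < 1) :
    ramSeries (1 / 2) x =
      (1 - x / q) ^ (-(1 / 2) : ℝ) * ramSeries s (κ * (x ^ r / (1 - x / q) ^ e)) := by
  have hq0 : 0 < q := one_pos.trans_le hq
  have hz1 : ∀ z ∈ Set.uIcc 0 x, |z| < 1 := by
    intro z hz
    have := Set.abs_sub_left_of_mem_uIcc hz
    simp only [sub_zero] at this
    exact this.trans_lt hx
  have hzq : ∀ z ∈ Set.uIcc 0 x, 0 < 1 - z / q := by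
    intro z hz
    rw [sub_pos, div_lt_one hq0]
    exact ((le_abs_self z).trans_lt (hz1 z hz)).trans_le hq
  have hF : AnalyticOnNhd ℝ (ramSeries (1 / 2)) (Set.uIcc 0 x) := fun z hz =>
    analyticAt_ramSeries (by norm_num) (by norm_num) (hz1 z hz)
  have hG : AnalyticOnNhd ℝ (fun z => (1 - z / q) ^ (-(1 / 2) : ℝ) *
      ramSeries s (κ * (z ^ r / (1 - z / q) ^ e))) (Set.uIcc 0 x) := by
    intro z hz
    have hl : AnalyticAt ℝ (fun z : ℝ => 1 - z / q) z :=
      analyticAt_const.sub (analyticAt_id.div_const)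
    refine AnalyticAt.mul ?_ ?_
    · have hexp : AnalyticAt ℝ (fun z : ℝ => Real.exp (Real.log (1 - z / q) * (-(1 / 2)))) z :=
        ((hl.log (hzq z hz)).mul analyticAt_const).rexp
      refine hexp.congr ?_
      filter_upwards [hl.continuousAt.eventually (lt_mem_nhds (hzq z hz))] with w hw
      rw [Real.rpow_def_of_pos hw]
    · exact (analyticAt_ramSeries h0 h1 (hU z hz)).comp_of_eq
        (analyticAt_const.mul ((analyticAt_id.pow r).div (hl.pow e)
          (pow_ne_zero e (hzq z hz).ne'))) rfl
  refine hF.eqOn_of_preconnected_of_eventuallyEq hG isPreconnected_uIcc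
    (Set.left_mem_uIcc : (0 : ℝ) ∈ Set.uIcc 0 x) ?_ Set.right_mem_uIcc
  have hcont : ContinuousAt (fun z : ℝ => |κ| * (|z| ^ r / (1 - |z| / q) ^ e)) 0 := by
    refine continuousAt_const.mul (ContinuousAt.div (by fun_prop) (by fun_prop) (by simp))
  -- As `r > 0`, the bound needed for rearrangement has value 0 at the origin, so it holds nearby.
  have hev := hcont.eventually (gt_mem_nhds (show _ < (1 : ℝ) by simp [hr.ne']))
  filter_upwards [hev, Metric.ball_mem_nhds (0 : ℝ) hq0] with z hz hzb
  exact ramSeries_half_eq_of_coeff h0 h1 hq0 hr hc (by simpa using hzb) hz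

theorem mul_deriv_ramSeries_half {s q κ x : ℝ} {r e : ℕ} (h0 : 0 < s) (h1 : s < 1)
    (hq : 0 < q) (hx0 : x ≠ 0) (hx : 0 < 1 - x / q)
    (hy : |κ * (x ^ r / (1 - x / q) ^ e)| < 1)
    (hev : ∀ᶠ z in nhds x, ramSeries (1 / 2) z =
      (1 - z / q) ^ (-(1 / 2) : ℝ) * ramSeries s (κ * (z ^ r / (1 - z / q) ^ e))) :
    x * deriv (ramSeries (1 / 2)) x = (1 - x / q) ^ (-(1 / 2) : ℝ) *
      (x / q / (2 * (1 - x / q)) * ramSeries s (κ * (x ^ r / (1 - x / q) ^ e)) +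
        (r + e * (x / q) / (1 - x / q)) * (κ * (x ^ r / (1 - x / q) ^ e) *
          deriv (ramSeries s) (κ * (x ^ r / (1 - x / q) ^ e)))) := by
  have hl : HasDerivAt (fun z : ℝ => 1 - z / q) (-(1 / q)) x := by
    simpa using ((hasDerivAt_id x).div_const q).const_sub 1
  have hp := hl.rpow_const (p := (-(1 / 2) : ℝ)) (Or.inl hx.ne')
  have hin := ((hasDerivAt_pow r x).div (hl.pow e) (pow_ne_zero e hx.ne')).const_mul κ
  have hs := (analyticAt_ramSeries h0 h1 hy).differentiableAt.hasDerivAt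
  have hd := hp.mul (hs.comp x hin)
  rw [show deriv (ramSeries (1 / 2)) x = _ from (Filter.EventuallyEq.deriv_eq hev).trans hd.deriv]
  rw [Real.rpow_sub_one hx.ne']
  have hr : (r : ℝ) * x ^ (r - 1) = r * x ^ r / x := by
    rcases r with _ | r
    · simp
    · rw [Nat.add_sub_cancel, pow_succ, ← mul_assoc, mul_div_cancel_right₀ _ hx0]
  have he : (e : ℝ) * (1 - x / q) ^ (e - 1) = e * (1 - x / q) ^ e / (1 - x / q) := by
    rcases e with _ | e
    · simp
    · rw [Nat.add_sub_cancel, pow_succ, ← mul_assoc, mul_div_cancel_right₀ _ hx.ne']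
  simp only [Pi.pow_apply, Function.comp_apply, hr, he]
  set y := 1 - x / q with hydef
  have hy0 := hx.ne'
  have hye : y ^ e ≠ 0 := pow_ne_zero e hy0
  -- With the analytic values made opaque, only a rational identity remains.
  generalize ramSeries s (κ * (x ^ r / y ^ e)) = A
  generalize deriv (ramSeries s) (κ * (x ^ r / y ^ e)) = B
  generalize y ^ (-(1 / 2) : ℝ) = C
  field_simp
  ring

theorem ramSeries_half_eq_quarter {x : ℝ} (hx : |x| < 1)
    (hy : |-(4 * x) / (1 - x) ^ 2| < 1) :
    ramSeries (1 / 2) x =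
      (1 - x / 1) ^ (-(1 / 2) : ℝ) * ramSeries (1 / 4) (-4 * (x ^ 1 / (1 - x / 1) ^ 2)) := by
  obtain ⟨hxl, hxr⟩ := abs_lt.1 hx
  refine ramSeries_half_eq (by norm_num) (by norm_num) le_rfl one_pos sum_rowCoeff_quarter hx ?_
  have h1x : 0 < 1 - x := by linarith
  rw [abs_div, abs_of_pos (pow_pos h1x 2), div_lt_one (by positivity), abs_neg, abs_mul,
    abs_of_pos (by norm_num : (0 : ℝ) < 4)] at hy
  intro z hz
  have h1z : 0 < 1 - z := by
    have := (Set.mem_uIcc.1 hz)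
    rcases this with h | h <;> linarith [h.1, h.2]
  rw [div_one, pow_one, ← mul_div_assoc, abs_div, abs_of_pos (pow_pos h1z 2),
    div_lt_one (by positivity), abs_mul, abs_neg, abs_of_pos (by norm_num : (0 : ℝ) < 4)]
  rcases Set.mem_uIcc.1 hz with h | h
  · rw [abs_of_nonneg h.1]
    rw [abs_of_nonneg (h.1.trans h.2)] at hy
    nlinarith [h.1, h.2]
  · rw [abs_of_nonpos h.2]
    -- For negative `z` the bound is `(1-z)² + 4z = (1+z)² > 0`.
    nlinarith [mul_pos (show 0 < 1 + z by linarith [h.1]) (show 0 < 1 + z by linarith [h.1])]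

theorem abs_sixth_argument_lt_one {x : ℝ} (hx : |x| < 1) :
    |27 * x ^ 2 / (4 - x) ^ 3| < 1 := by
  obtain ⟨hxl, hxr⟩ := abs_lt.1 hx
  have h3 : 3 < 4 - x := by linarith
  have h27 : (3 : ℝ) ^ 3 < (4 - x) ^ 3 := by gcongr
  have hx2 : x ^ 2 < 1 := (sq_lt_one_iff_abs_lt_one x).2 hx
  rw [abs_div, abs_of_pos (by linarith : (0 : ℝ) < (4 - x) ^ 3), div_lt_one (by linarith),
    abs_of_nonneg (by positivity)]
  linarith

theorem sixth_argument_eq {x : ℝ} (hx : |x| < 1) :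
    27 / 64 * (x ^ 2 / (1 - x / 4) ^ 3) = 27 * x ^ 2 / (4 - x) ^ 3 := by
  have h : (4 - x) ≠ 0 := by linarith [(abs_lt.1 hx).2]
  rw [show 1 - x / 4 = (4 - x) / 4 by ring]
  field_simp
  ring

theorem ramSeries_half_eq_sixth {x : ℝ} (hx : |x| < 1) :
    ramSeries (1 / 2) x =
      (1 - x / 4) ^ (-(1 / 2) : ℝ) * ramSeries (1 / 6) (27 / 64 * (x ^ 2 / (1 - x / 4) ^ 3)) := by
  refine ramSeries_half_eq (by norm_num) (by norm_num) (by norm_num) two_pos sum_rowCoeff_sixth hx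
    fun z hz => ?_
  have hz1 : |z| < 1 := by
    have := Set.abs_sub_left_of_mem_uIcc hz
    simp only [sub_zero] at this
    exact this.trans_lt hx
  rw [sixth_argument_eq hz1]
  exact abs_sixth_argument_lt_one hz1

/-! ### Evaluation at -1/8 and the equivalences. -/

theorem rpow_neg_half {y : ℝ} (hy : 0 ≤ y) : y ^ (-(1 / 2) : ℝ) = (Real.sqrt y)⁻¹ := by
  rw [Real.rpow_neg hy, Real.sqrt_eq_rpow]

theorem half_value_eq_quarter :
    6 * (-(1 / 8) * deriv (ramSeries (1 / 2)) (-(1 / 8))) + 1 * ramSeries (1 / 2) (-(1 / 8)) =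
      4 * Real.sqrt 2 / 9 * (7 * (32 / 81 * deriv (ramSeries (1 / 4)) (32 / 81)) +
        1 * ramSeries (1 / 4) (32 / 81)) := by
  have hev : ∀ᶠ z : ℝ in nhds (-(1 / 8)), ramSeries (1 / 2) z =
      (1 - z / 1) ^ (-(1 / 2) : ℝ) * ramSeries (1 / 4) (-4 * (z ^ 1 / (1 - z / 1) ^ 2)) := by
    filter_upwards [Ioo_mem_nhds (show (-1 : ℝ) < -(1 / 8) by norm_num)
      (show (-(1 / 8) : ℝ) < 0 by norm_num)] with z hz
    refine ramSeries_half_eq_quarter (abs_lt.2 ⟨hz.1, hz.2.trans one_pos⟩) ?_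
    have h1 : 0 < 1 - z := by linarith [hz.2]
    rw [abs_of_pos (div_pos (by linarith [hz.2]) (by positivity)), div_lt_one (by positivity)]
    nlinarith [mul_pos (show 0 < 1 + z by linarith [hz.1]) (show 0 < 1 + z by linarith [hz.1])]
  have hd := mul_deriv_ramSeries_half (by norm_num) (by norm_num) one_pos (by norm_num)
    (by norm_num) (by norm_num [abs_of_pos]) hev
  -- The prefactor is `(9/8)^(-1/2)`. The derivative formula has coefficients `7/9` and `-1/18`, so
  -- `6θ + 1` becomes `(2/3)(7θ + 1)`, where `θ = x d/dx`.
  have hsqrt : Real.sqrt (9 / 8) = 3 * Real.sqrt 2 / 4 := by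
    rw [Real.sqrt_eq_iff_mul_self_eq (by norm_num) (by positivity)]
    linear_combination (-9 / 16) * Real.mul_self_sqrt (show (0 : ℝ) ≤ 2 by norm_num)
  rw [hd, hev.self_of_nhds]
  norm_num only [Nat.cast_ofNat, Nat.cast_one]
  rw [rpow_neg_half (by norm_num), hsqrt]
  have h2 : Real.sqrt 2 ^ 2 = 2 := Real.sq_sqrt (by norm_num)
  field_simp
  rw [h2]
  ring

theorem half_value_eq_sixth :
    6 * (-(1 / 8) * deriv (ramSeries (1 / 2)) (-(1 / 8))) + 1 * ramSeries (1 / 2) (-(1 / 8)) =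
      2 * Real.sqrt 2 / (11 * Real.sqrt 33) *
        (252 * (8 / 1331 * deriv (ramSeries (1 / 6)) (8 / 1331)) +
        20 * ramSeries (1 / 6) (8 / 1331)) := by
  have hev : ∀ᶠ z : ℝ in nhds (-(1 / 8)), ramSeries (1 / 2) z =
      (1 - z / 4) ^ (-(1 / 2) : ℝ) *
        ramSeries (1 / 6) (27 / 64 * (z ^ 2 / (1 - z / 4) ^ 3)) := by
    filter_upwards [Ioo_mem_nhds (show (-1 : ℝ) < -(1 / 8) by norm_num)
      (show (-(1 / 8) : ℝ) < 0 by norm_num)] with z hz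
    exact ramSeries_half_eq_sixth (abs_lt.2 ⟨hz.1, hz.2.trans one_pos⟩)
  have hd := mul_deriv_ramSeries_half (by norm_num) (by norm_num) (by norm_num) (by norm_num)
    (by norm_num) (by norm_num [abs_of_pos]) hev
  -- Here the coefficients are `21/11` and `-1/66`, so `6θ + 1` becomes `(1/22)(252θ + 20)`.
  have hsqrt : Real.sqrt (33 / 32) = Real.sqrt 33 * Real.sqrt 2 / 8 := by
    rw [Real.sqrt_eq_iff_mul_self_eq (by norm_num) (by positivity)]
    have h2 := Real.mul_self_sqrt (show (0 : ℝ) ≤ 2 by norm_num)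
    have h33 := Real.mul_self_sqrt (show (0 : ℝ) ≤ 33 by norm_num)
    linear_combination (-1 / 64) * Real.sqrt 33 * Real.sqrt 33 * h2 - (1 / 32) * h33
  rw [hd, hev.self_of_nhds]
  norm_num only [Nat.cast_ofNat, Nat.cast_one]
  rw [rpow_neg_half (by norm_num), hsqrt]
  have h2 : Real.sqrt 2 ^ 2 = 2 := Real.sq_sqrt (by norm_num)
  field_simp
  rw [h2]
  ring

theorem HasSum.iff_eq {f : ℕ → ℝ} {a : ℝ} (h : HasSum f a) (b : ℝ) : HasSum f b ↔ a = b :=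
  ⟨fun hb => h.unique hb, fun hb => hb ▸ h⟩

/-- Both series converge for any `c`, so only their values matter, and these differ by the nonzero
factor `4√2/9`. -/
theorem hasSum_quarter_iff (c : ℝ) :
    HasSum (fun n : ℕ => ramCoeff (1 / 4) n * (7 * (n : ℝ) + 1) * (32 / 81 : ℝ) ^ n)
        (9 / 2 * c) ↔
      HasSum (fun n : ℕ => ramCoeff (1 / 2) n * (6 * (n : ℝ) + 1) * (-(1 / 8) : ℝ) ^ n)
        (2 * Real.sqrt 2 * c) := by
  rw [(hasSum_linear_mul_ramCoeff (s := 1 / 4) (by norm_num) (by norm_num)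
    (by norm_num [abs_of_pos]) 7 1).iff_eq, (hasSum_linear_mul_ramCoeff (s := 1 / 2) (by norm_num)
    (by norm_num) (by norm_num [abs_of_pos]) 6 1).iff_eq, half_value_eq_quarter,
    ← mul_right_inj' (show 4 * Real.sqrt 2 / 9 ≠ 0 by positivity)]
  ring_nf

theorem hasSum_sixth_iff (c : ℝ) :
    HasSum (fun n : ℕ => ramCoeff (1 / 6) n * (252 * (n : ℝ) + 20) * (2 / 11 : ℝ) ^ (3 * n))
        (11 * Real.sqrt 33 * c) ↔
      HasSum (fun n : ℕ => ramCoeff (1 / 2) n * (6 * (n : ℝ) + 1) * (-(1 / 8) : ℝ) ^ n)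
        (2 * Real.sqrt 2 * c) := by
  simp only [pow_mul, show (2 / 11 : ℝ) ^ 3 = 8 / 1331 by norm_num]
  rw [(hasSum_linear_mul_ramCoeff (s := 1 / 6) (by norm_num) (by norm_num)
    (by norm_num [abs_of_pos]) 252 20).iff_eq, (hasSum_linear_mul_ramCoeff (s := 1 / 2)
    (by norm_num) (by norm_num) (by norm_num [abs_of_pos]) 6 1).iff_eq, half_value_eq_sixth,
    ← mul_right_inj' (show 2 * Real.sqrt 2 / (11 * Real.sqrt 33) ≠ 0 by positivity),
    show 2 * Real.sqrt 2 / (11 * Real.sqrt 33) * (11 * Real.sqrt 33 * c) = 2 * Real.sqrt 2 * c by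
      field_simp]

theorem mainTheorem8 :
    -- the two transformations of the hypergeometric series, where both sides converge
    (∀ x : ℝ, |x| < 1 → |-(4 * x) / (1 - x) ^ 2| < 1 →
      Summable (hypTerm (1 / 2) (1 / 2) (1 / 2) 1 1 x) ∧
      Summable (hypTerm (1 / 2) (1 / 4) (3 / 4) 1 1 (-(4 * x) / (1 - x) ^ 2)) ∧
      hyp3F2 (1 / 2) (1 / 2) (1 / 2) 1 1 x =
        (1 - x) ^ (-(1 / 2) : ℝ) *
          hyp3F2 (1 / 2) (1 / 4) (3 / 4) 1 1 (-(4 * x) / (1 - x) ^ 2)) ∧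
    (∀ x : ℝ, |x| < 1 →
      Summable (hypTerm (1 / 2) (1 / 2) (1 / 2) 1 1 x) ∧
      Summable (hypTerm (1 / 2) (1 / 6) (5 / 6) 1 1 (27 * x ^ 2 / (4 - x) ^ 3)) ∧
      hyp3F2 (1 / 2) (1 / 2) (1 / 2) 1 1 x =
        (1 - x / 4) ^ (-(1 / 2) : ℝ) *
          hyp3F2 (1 / 2) (1 / 6) (5 / 6) 1 1 (27 * x ^ 2 / (4 - x) ^ 3)) ∧
    -- the two equivalences, with an arbitrary real `c` in the place of `1 / π`
    (∀ c : ℝ,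
      HasSum (fun n : ℕ => ramCoeff (1 / 4) n * (7 * (n : ℝ) + 1) * (32 / 81 : ℝ) ^ n)
        (9 / 2 * c) ↔
      HasSum (fun n : ℕ => ramCoeff (1 / 2) n * (6 * (n : ℝ) + 1) * (-(1 / 8) : ℝ) ^ n)
        (2 * Real.sqrt 2 * c)) ∧
    (∀ c : ℝ,
      HasSum (fun n : ℕ => ramCoeff (1 / 6) n * (252 * (n : ℝ) + 20) * (2 / 11 : ℝ) ^ (3 * n))
        (11 * Real.sqrt 33 * c) ↔
      HasSum (fun n : ℕ => ramCoeff (1 / 2) n * (6 * (n : ℝ) + 1) * (-(1 / 8) : ℝ) ^ n)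
        (2 * Real.sqrt 2 * c)) ∧
    -- the three summation formulas
    HasSum (fun n : ℕ => ramCoeff (1 / 2) n * (6 * (n : ℝ) + 1) * (-(1 / 8) : ℝ) ^ n)
      (2 * Real.sqrt 2 / Real.pi) ∧
    HasSum (fun n : ℕ => ramCoeff (1 / 4) n * (7 * (n : ℝ) + 1) * (32 / 81 : ℝ) ^ n)
      (9 / (2 * Real.pi)) ∧
    HasSum (fun n : ℕ => ramCoeff (1 / 6) n * (252 * (n : ℝ) + 20) * (2 / 11 : ℝ) ^ (3 * n))
      (11 * Real.sqrt 33 / Real.pi) := by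
  refine ⟨fun x hx hy => ?_, fun x hx => ?_, hasSum_quarter_iff, hasSum_sixth_iff,
    hasSum_ramCoeff_half, ?_, ?_⟩
  · have h2 := hypTerm_eq_ramCoeff (1 / 2) x
    have h4 := hypTerm_eq_ramCoeff (1 / 4) (-(4 * x) / (1 - x) ^ 2)
    rw [show (1 : ℝ) - 1 / 2 = 1 / 2 by norm_num] at h2
    rw [show (1 : ℝ) - 1 / 4 = 3 / 4 by norm_num] at h4
    rw [hyp3F2, hyp3F2, h2, h4]
    refine ⟨summable_ramCoeff (by norm_num) (by norm_num) hx,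
      summable_ramCoeff (by norm_num) (by norm_num) hy, ?_⟩
    have h := ramSeries_half_eq_quarter hx hy
    rwa [div_one, pow_one, ← mul_div_assoc, neg_mul] at h
  · have h2 := hypTerm_eq_ramCoeff (1 / 2) x
    have h6 := hypTerm_eq_ramCoeff (1 / 6) (27 * x ^ 2 / (4 - x) ^ 3)
    rw [show (1 : ℝ) - 1 / 2 = 1 / 2 by norm_num] at h2
    rw [show (1 : ℝ) - 1 / 6 = 5 / 6 by norm_num] at h6
    rw [hyp3F2, hyp3F2, h2, h6]
    refine ⟨summable_ramCoeff (by norm_num) (by norm_num) hx,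
      summable_ramCoeff (by norm_num) (by norm_num) (abs_sixth_argument_lt_one hx), ?_⟩
    have h := ramSeries_half_eq_sixth hx
    rwa [sixth_argument_eq hx] at h
  · rw [show 9 / (2 * Real.pi) = 9 / 2 * (1 / Real.pi) by ring, hasSum_quarter_iff, mul_one_div]
    exact hasSum_ramCoeff_half
  · rw [← mul_one_div (11 * Real.sqrt 33), hasSum_sixth_iff, mul_one_div]
    exact hasSum_ramCoeff_half
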